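/- Consider best arm identification with $n \ge 2$ arms. An instance $I$ assigns to each arm a reward distribution supported on $[0,1]$. An algorithm (possibly randomized) adaptively samples arms one at a time, each sample of an arm giving an independent reward from its distribution; it may stop at any time depending on what it has observed, and then returns an arm. It is called $\delta$-correct if, on every instance with a unique arm of maximal mean reward (the best arm), it returns the best arm with probability at least $1-\delta$. Let $T(I)\in\{0,1,2,\dots\}\cup\{\infty\}$ denote the total number of samples it takes on $I$. **Theorem.** Let $n \ge 2$, let $\sigma_1,\dots,\sigma_n$ be real numbers with $\sigma_i^2 < 0.1$ for all $i$, and let $0 < \Delta_2 \le \Delta_3 \le \cdots \le \Delta_n < 0.1$; put $\Delta_1 := \Delta_2$. Then there is an instance $I$ with a unique best arm, in which each reward distribution is supported on at most two points, such that the $i$-th best arm has reward variance $\sigma_i^2$ for $1\le i\le n$ and its mean is smaller than that of the best arm by exactly $\Delta_i$ for $2 \le i \le n$, and such that for every $\delta \in (0, 0.1)$ and every $\delta$-correct algorithm, $$\mathbb{E}[T(I)] \;\ge\; \frac{1}{80} \sum_{i=1}^n \left( \frac{\sigma_i^2}{\Delta_i^2} + \frac{1}{\Delta_i} \right) \ln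 \delta^{-1} .$$ -/

import Mathlib

open MeasureTheory ProbabilityTheory
open scoped ENNReal

universe u

namespace BestArm

/-- An instance of the `n`-armed bandit: each arm has a reward distribution supported on `[0, 1]`. -/
structure Instance (n : ℕ) where
  reward : Fin n → Measure ℝ
  isProb : ∀ i, IsProbabilityMeasure (reward i)
  supported : ∀ i, ∀ᵐ y ∂(reward i), y ∈ Set.Icc (0 : ℝ) 1

attribute [instance] Instance.isProb

namespace Instance

/-- The mean reward of arm `i`. -/
noncomputable def mean {n : ℕ} (I : Instance n) (i : Fin n) : ℝ :=
  ∫ y, y ∂(I.reward i)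

/-- The variance of the reward of arm `i`. -/
noncomputable def var {n : ℕ} (I : Instance n) (i : Fin n) : ℝ :=
  variance (fun y : ℝ => y) (I.reward i)

/-- Arm `i` is the (unique) best arm of the instance. -/
def IsBest {n : ℕ} (I : Instance n) (i : Fin n) : Prop :=
  ∀ j, j ≠ i → I.mean j < I.mean i

/-- The instance has variances `v` and gaps `Δ`: for some ranking `ρ` of the arms by decreasing
mean, `ρ 0` is the best arm, and for every `i` the arm `ρ i` ranked `i`-th (from `0`) has variance
`v i` and, if it is not the best arm, its mean is smaller than that of the best arm by `Δ i`.
The value `Δ 0` plays no role. -/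
def HasParameters {n : ℕ} (hn : 2 ≤ n) (I : Instance n) (v Δ : Fin n → ℝ) : Prop :=
  ∃ ρ : Equiv.Perm (Fin n),
    I.IsBest (ρ ⟨0, by omega⟩) ∧
    Antitone (fun i => I.mean (ρ i)) ∧
    (∀ i, I.var (ρ i) = v i) ∧
    ∀ i, i ≠ ⟨0, by omega⟩ → I.mean (ρ ⟨0, by omega⟩) - I.mean (ρ i) = Δ i

end Instance

/-- What the player has seen after `t` samples: the arms sampled and the rewards observed. -/
abbrev History (n t : ℕ) : Type := Fin t → Fin n × ℝ

/-- A (possibly randomized) adaptive best arm identification algorithm for `n` arms. It draws a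
random seed at the start. After `t` samples it decides from the seed and the history whether to
stop; if it stops it returns the arm `answer`, otherwise it samples the arm `sample` next. -/
structure Algorithm (n : ℕ) where
  Seed : Type u
  seedSpace : MeasurableSpace Seed
  seedLaw : Measure Seed
  seedLaw_isProb : IsProbabilityMeasure seedLaw
  sample : (t : ℕ) → Seed × History n t → Fin n
  stopSet : (t : ℕ) → Set (Seed × History n t)
  answer : (t : ℕ) → Seed × History n t → Fin n
  measurable_sample : ∀ t, Measurable (sample t)
  measurableSet_stopSet : ∀ t, MeasurableSet (stopSet t)
  measurable_answer : ∀ t, Measurable (answer t)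

attribute [instance] Algorithm.seedSpace Algorithm.seedLaw_isProb

namespace Algorithm

variable {n : ℕ}

/-- The sources of randomness of a run: the seed, and a table `x` of potential rewards, where
`x t i` is the reward observed if the sample number `t` (from `0`) is taken from arm `i`. -/
abbrev Outcome (A : Algorithm.{u} n) : Type u := A.Seed × (ℕ → Fin n → ℝ)

/-- The law of the randomness on instance `I`: the seed and all potential rewards are independent,
and every potential reward of arm `i` has law `I.reward i`. -/
noncomputable def law (A : Algorithm.{u} n) (I : Instance n) : Measure A.Outcome :=
  A.seedLaw.prod (Measure.infinitePi fun _ : ℕ => Measure.pi I.reward)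

/-- The history of the first `t` samples when the sampling rule is followed. (Histories longer
than the stopping time are hypothetical and are not used below.) -/
def history (A : Algorithm.{u} n) (ω : A.Outcome) : (t : ℕ) → History n t
  | 0 => Fin.elim0
  | t + 1 =>
    let i : Fin n := A.sample t (ω.1, history A ω t)
    Fin.snoc (α := fun _ => Fin n × ℝ) (history A ω t) (i, ω.2 t i)

/-- The stopping rule is satisfied after `t` samples. -/
def WantsStop (A : Algorithm.{u} n) (ω : A.Outcome) (t : ℕ) : Prop :=
  (ω.1, A.history ω t) ∈ A.stopSet t

/-- The total number of samples taken: the first time at which the stopping rule is satisfied,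
and `⊤` if there is none. -/
noncomputable def sampleCount (A : Algorithm.{u} n) (ω : A.Outcome) : ℕ∞ :=
  ⨅ (t : ℕ) (_ : A.WantsStop ω t), (t : ℕ∞)

/-- The algorithm stops and returns arm `i`. -/
def Returns (A : Algorithm.{u} n) (ω : A.Outcome) (i : Fin n) : Prop :=
  ∃ t, A.WantsStop ω t ∧ (∀ r < t, ¬ A.WantsStop ω r) ∧ A.answer t (ω.1, A.history ω t) = i

/-- `δ`-correctness: on every instance with a unique best arm, the algorithm returns the best arm
with probability at least `1 - δ`. -/
def IsCorrect (A : Algorithm.{u} n) (δ : ℝ) : Prop :=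
  ∀ (I : Instance n) (i : Fin n), I.IsBest i →
    ENNReal.ofReal (1 - δ) ≤ A.law I {ω | A.Returns ω i}

/-- The expected number of samples on instance `I` (possibly infinite). -/
noncomputable def expectedSamples (A : Algorithm.{u} n) (I : Instance n) : ℝ≥0∞ :=
  ∫⁻ ω, (A.sampleCount ω : ℝ≥0∞) ∂(A.law I)

end Algorithm

end BestArm

/-! The hard instance uses symmetric two-point rewards `m i ± σ i`, with means 1/2 for the best arm
and 1/2 - Δ_i for the others. It suffices to show that each arm k is sampled at least
(1/80)(σ_k²/Δ_k² + 1/Δ_k) ln δ⁻¹ times in expectation on the event that the best arm is returned,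
and to sum over k.

Fix k. Moving the mean of arm k by Δ_k (up for a suboptimal arm, down for the best one) gives an
instance I' in which another arm ties for the lead. By `law_returns_le` the original best arm is
returned there with probability at most δ, although δ-correctness itself says nothing about ties.

The comparison of I with I' avoids relative entropy at a stopping time. It uses a second instance
I'', the mirror image of I'. If G and H are the likelihood weights of a run for I' and I'', the
first-order terms of the logarithms cancel, and GH ≥ exp(-κ N_k) holds for every run, N_k being the
number of samples of arm k. Together with log u ≤ u - 1 this yields 2 + ℓ ≤ e^ℓ G + H + κ N_k
pointwise. Integrating over the return event gives `transport`; ℓ = ln δ⁻¹ then gives E[N_k] ≥ (4/5)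
ℓ / κ.

`exists_alternative` supplies the cost κ = 64/(s²/D² + 1/D). If s² ≥ D, the two atoms are
reweighted, at cost of order D²/s². If s² ≤ D, a mass of order D is moved to an endpoint of [0, 1],
at cost of order D; here only a lower bound for the density is available, which is why densities
enter through inequalities. -/

namespace BestArm

/-! ### Independence of each sample from the past -/

/-- In a sequence of independent identically distributed variables, the variable number `t` can be
integrated out separately from a function of the earlier ones. -/
theorem lintegral_infinitePi_past_present {Ω E : Type*} [MeasurableSpace Ω] [Inhabited Ω]
    [MeasurableSpace E] (μ : Measure Ω) [IsProbabilityMeasure μ] (t : ℕ) (H : (ℕ → Ω) → E)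
    (hH : Measurable H) (hdep : ∀ x y : ℕ → Ω, (∀ s < t, x s = y s) → H x = H y)
    (F : E × Ω → ℝ≥0∞) (hF : Measurable F) :
    ∫⁻ x, F (H x, x t) ∂(Measure.infinitePi fun _ : ℕ => μ) =
      ∫⁻ x, ∫⁻ z, F (H x, z) ∂μ ∂(Measure.infinitePi fun _ : ℕ => μ) := by
  set P := Measure.infinitePi fun _ : ℕ => μ with hP
  have hind : iIndepFun (fun (s : ℕ) (x : ℕ → Ω) => x s) P :=
    iIndepFun_infinitePi (P := fun _ : ℕ => μ) (X := fun _ x => x) (fun _ => measurable_id)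
  have h1 := hind.indepFun_finset (Finset.range t) {t} (by simp) (fun s => measurable_pi_apply s)
  -- The default values beyond time `t` are harmless, since `H` depends only on the earlier
  -- coordinates.
  let ext : (Finset.range t → Ω) → (ℕ → Ω) :=
    fun r s => if h : s ∈ Finset.range t then r ⟨s, h⟩ else default
  have hext : Measurable ext := by
    refine measurable_pi_iff.2 fun s => ?_
    by_cases h : s ∈ Finset.range t
    · simp only [ext, h, dite_true]; exact measurable_pi_apply _
    · simp only [ext, h, dite_false]; exact measurable_const
  have hproj : Measurable fun r : ({t} : Finset ℕ) → Ω => r ⟨t, by simp⟩ := measurable_pi_apply _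
  have h2 := h1.comp (φ := fun r => H (ext r))
    (ψ := fun r : ({t} : Finset ℕ) → Ω => r ⟨t, by simp⟩) (hH.comp hext) hproj
  have hHe : (fun x : ℕ → Ω => H (ext fun i : Finset.range t => x i)) = H := by
    funext x
    refine hdep _ _ fun s hs => ?_
    simp [ext, hs]
  have h3 : IndepFun H (fun x : ℕ → Ω => x t) P := by
    have := h2
    simp only [Function.comp_def] at this
    rwa [hHe] at this
  have hev : P.map (fun x : ℕ → Ω => x t) = μ := Measure.infinitePi_map_eval _ t
  have hmap := (indepFun_iff_map_prod_eq_prod_map_map hH.aemeasurable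
    (measurable_pi_apply t).aemeasurable).1 h3
  rw [hev] at hmap
  have hm : Measurable fun x : ℕ → Ω => (H x, x t) := hH.prodMk (measurable_pi_apply t)
  have : IsProbabilityMeasure (P.map H) := Measure.isProbabilityMeasure_map hH.aemeasurable
  rw [← lintegral_map hF hm, hmap, lintegral_prod _ hF.aemeasurable,
    lintegral_map hF.lintegral_prod_right' hH]

theorem measurable_snoc {α : Type*} [MeasurableSpace α] (t : ℕ) :
    Measurable fun p : (Fin t → α) × α => (Fin.snoc (α := fun _ => α) p.1 p.2 : Fin (t + 1) → α) := by
  refine measurable_pi_iff.2 fun i => ?_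
  refine Fin.lastCases ?_ (fun j => ?_) i
  · simpa using measurable_snd
  · simpa [Function.comp_def] using (measurable_pi_apply j).comp measurable_fst

namespace Algorithm

variable {n : ℕ} (A : Algorithm.{u} n)

/-- The seed together with the history of the first `t` samples. -/
def state (t : ℕ) (ω : A.Outcome) : A.Seed × History n t := (ω.1, A.history ω t)

/-- The state after one more sample, if the potential rewards of that sample are `z`. -/
def next (t : ℕ) (x : A.Seed × History n t) (z : Fin n → ℝ) : A.Seed × History n (t + 1) :=
  (x.1, Fin.snoc (α := fun _ => Fin n × ℝ) x.2 (A.sample t x, z (A.sample t x)))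

theorem state_succ (t : ℕ) (ω : A.Outcome) :
    A.state (t + 1) ω = A.next t (A.state t ω) (ω.2 t) := rfl

theorem measurable_next (t : ℕ) :
    Measurable fun p : (A.Seed × History n t) × (Fin n → ℝ) => A.next t p.1 p.2 := by
  have ha : Measurable fun p : (A.Seed × History n t) × (Fin n → ℝ) => A.sample t p.1 :=
    (A.measurable_sample t).comp measurable_fst
  have hz : Measurable fun p : (A.Seed × History n t) × (Fin n → ℝ) => p.2 (A.sample t p.1) := by
    have h : Measurable fun q : Fin n × (Fin n → ℝ) => q.2 q.1 :=
      measurable_from_prod_countable_right fun i => measurable_pi_apply i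
    exact h.comp (ha.prodMk measurable_snd)
  exact (measurable_fst.comp measurable_fst).prodMk
    ((measurable_snoc t).comp ((measurable_snd.comp measurable_fst).prodMk (ha.prodMk hz)))

theorem measurable_state (t : ℕ) : Measurable (A.state t) := by
  induction t with
  | zero =>
    exact measurable_fst.prodMk (measurable_pi_iff.2 fun i => i.elim0)
  | succ t ih =>
    exact (A.measurable_next t).comp
      (ih.prodMk ((measurable_pi_apply t).comp measurable_snd))

theorem state_congr (t : ℕ) (s : A.Seed) (x y : ℕ → Fin n → ℝ) (h : ∀ r < t, x r = y r) :
    A.state t (s, x) = A.state t (s, y) := by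
  induction t with
  | zero => rfl
  | succ t ih =>
    rw [state_succ, state_succ, ih fun r hr => h r (by omega)]
    exact congrArg _ (h t (by omega))

instance (I : Instance n) : IsProbabilityMeasure (A.law I) := by
  unfold law; infer_instance

/-- The potential rewards of sample number `t` can be integrated out separately. -/
theorem lintegral_state_succ (I : Instance n) (t : ℕ)
    (F : A.Seed × History n (t + 1) → ℝ≥0∞) (hF : Measurable F) :
    ∫⁻ ω, F (A.state (t + 1) ω) ∂(A.law I) =
      ∫⁻ ω, ∫⁻ z, F (A.next t (A.state t ω) z) ∂(Measure.pi I.reward) ∂(A.law I) := by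
  have hG : Measurable fun p : (A.Seed × History n t) × (Fin n → ℝ) => F (A.next t p.1 p.2) :=
    hF.comp (A.measurable_next t)
  have hF' : Measurable fun ω => F (A.state (t + 1) ω) := hF.comp (A.measurable_state _)
  have hG' : Measurable fun ω =>
      ∫⁻ z, F (A.next t (A.state t ω) z) ∂(Measure.pi I.reward) :=
    hG.lintegral_prod_right'.comp (A.measurable_state t)
  unfold law
  rw [lintegral_prod _ hF'.aemeasurable, lintegral_prod _ hG'.aemeasurable]
  refine lintegral_congr fun s => ?_
  exact lintegral_infinitePi_past_present (Measure.pi I.reward) t (fun x => A.state t (s, x))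
    ((A.measurable_state t).comp measurable_prodMk_left) (A.state_congr t s) _ hG

/-! ### Change of measure along a history -/

/-- The product of the weights of the samples in a history. -/
noncomputable def weight {t : ℕ} (g : Fin n → ℝ → ℝ≥0∞) (x : History n t) : ℝ≥0∞ :=
  ∏ s, g (x s).1 (x s).2

theorem measurable_weight {t : ℕ} {g : Fin n → ℝ → ℝ≥0∞} (hg : ∀ k, Measurable (g k)) :
    Measurable (weight g : History n t → ℝ≥0∞) := by
  have h : Measurable fun q : Fin n × ℝ => g q.1 q.2 := measurable_from_prod_countable_right hg
  exact Finset.measurable_prod _ fun s _ => h.comp (measurable_pi_apply s)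

theorem weight_next {t : ℕ} (g : Fin n → ℝ → ℝ≥0∞) (x : A.Seed × History n t)
    (z : Fin n → ℝ) :
    weight g (A.next t x z).2 = weight g x.2 * g (A.sample t x) (z (A.sample t x)) := by
  simp [weight, next, Fin.prod_univ_castSucc]

/-- `g` is a lower bound for the density of the rewards of `I'` with respect to those of `I`. -/
def _root_.BestArm.Instance.DensityLE (I I' : Instance n) (g : Fin n → ℝ → ℝ≥0∞) : Prop :=
  ∀ k, ∀ f : ℝ → ℝ≥0∞, Measurable f →
    ∫⁻ y, g k y * f y ∂(I.reward k) ≤ ∫⁻ y, f y ∂(I'.reward k)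

/-- Change of measure for functions of the first `t` samples. -/
theorem lintegral_weight_mul_le {I I' : Instance n} {g : Fin n → ℝ → ℝ≥0∞}
    (hg : ∀ k, Measurable (g k)) (h : I.DensityLE I' g) (t : ℕ)
    (F : A.Seed × History n t → ℝ≥0∞) (hF : Measurable F) :
    ∫⁻ ω, weight g (A.state t ω).2 * F (A.state t ω) ∂(A.law I) ≤
      ∫⁻ ω, F (A.state t ω) ∂(A.law I') := by
  induction t with
  | zero =>
    have h0 : ∀ J : Instance n, ∫⁻ ω, F (A.state 0 ω) ∂(A.law J) =
        ∫⁻ s, F (s, Fin.elim0) ∂A.seedLaw := fun J => by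
      have hF' : Measurable fun ω => F (A.state 0 ω) := hF.comp (A.measurable_state _)
      unfold law
      rw [lintegral_prod _ hF'.aemeasurable]
      simp [state, history]
    simp only [weight, Finset.univ_eq_empty, Finset.prod_empty, one_mul]
    rw [h0, h0]
  | succ t ih =>
    have hG : Measurable fun p : (A.Seed × History n t) × (Fin n → ℝ) => F (A.next t p.1 p.2) :=
      hF.comp (A.measurable_next t)
    have hGz : ∀ x : A.Seed × History n t, Measurable fun y : ℝ =>
        F (x.1, Fin.snoc (α := fun _ => Fin n × ℝ) x.2 (A.sample t x, y)) := fun x =>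
      hF.comp (measurable_const.prodMk ((measurable_snoc t).comp
        (measurable_const.prodMk (measurable_const.prodMk measurable_id))))
    have heval : ∀ (J : Instance n) (k : Fin n) (f : ℝ → ℝ≥0∞), Measurable f →
        ∫⁻ z, f (z k) ∂(Measure.pi J.reward) = ∫⁻ y, f y ∂(J.reward k) := fun J k f hf =>
      (measurePreserving_eval J.reward k).lintegral_comp hf
    rw [A.lintegral_state_succ I t (fun x => weight g x.2 * F x)
        (((measurable_weight hg).comp measurable_snd).mul hF), A.lintegral_state_succ I' t F hF]
    -- The induction hypothesis is applied to the function that integrates `F` over the last sample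
    -- under `I'`; it remains to compare the last sample alone, with the past fixed.
    refine le_trans (lintegral_mono fun ω => ?_) (ih _ hG.lintegral_prod_right')
    set x := A.state t ω
    simp only [weight_next, mul_assoc]
    rw [lintegral_const_mul]
    · refine mul_le_mul_right ?_ _
      have h1 := heval I (A.sample t x) _ ((hg (A.sample t x)).mul (hGz x))
      have h2 := heval I' (A.sample t x) _ (hGz x)
      exact (h1.le.trans (h _ _ (hGz x))).trans h2.ge
    · exact ((hg _).comp (measurable_pi_apply _)).mul
        (hF.comp ((A.measurable_next t).comp measurable_prodMk_left))

end Algorithm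
end BestArm

/-! ### Stopping events and sample counts -/

namespace BestArm
namespace Algorithm

variable {n : ℕ} (A : Algorithm.{u} n)

/-- Earlier histories are prefixes of later ones, so "not stopped before `t`" can be read off the
state at time `t`. This lets the fixed-time change of measure apply to stopping events. -/
theorem history_castLE (ω : A.Outcome) {r t : ℕ} (h : r ≤ t) :
    (fun s => A.history ω t (Fin.castLE h s)) = A.history ω r := by
  induction t, h using Nat.le_induction with
  | base => rfl
  | succ t h ih =>
    rw [← ih]
    funext s
    have : Fin.castLE (Nat.le_succ_of_le h) s = (Fin.castLE h s).castSucc := rfl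
    rw [this, history, Fin.snoc_castSucc]

/-- The states after `t` samples in which the algorithm has just stopped, returning arm `i`. -/
def stopsWith (t : ℕ) (i : Fin n) : Set (A.Seed × History n t) :=
  {x | x ∈ A.stopSet t ∧
    (∀ r : Fin t, (x.1, fun s => x.2 (Fin.castLE r.2.le s)) ∉ A.stopSet r) ∧ A.answer t x = i}

theorem measurableSet_stopsWith (t : ℕ) (i : Fin n) : MeasurableSet (A.stopsWith t i) := by
  refine (A.measurableSet_stopSet t).inter (MeasurableSet.inter ?_ ?_)
  · have : {x : A.Seed × History n t |
        ∀ r : Fin t, (x.1, fun s => x.2 (Fin.castLE r.2.le s)) ∉ A.stopSet r} =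
        ⋂ r : Fin t, {x | (x.1, fun s => x.2 (Fin.castLE r.2.le s)) ∉ A.stopSet r} := by
      ext; simp
    change MeasurableSet {x : A.Seed × History n t |
        ∀ r : Fin t, (x.1, fun s => x.2 (Fin.castLE r.2.le s)) ∉ A.stopSet r}
    rw [this]
    refine MeasurableSet.iInter fun r => ?_
    have hm : Measurable fun x : A.Seed × History n t =>
        ((x.1, fun s => x.2 (Fin.castLE r.2.le s)) : A.Seed × History n r) :=
      measurable_fst.prodMk
        (measurable_pi_iff.2 fun s => (measurable_pi_apply _).comp measurable_snd)
    exact (hm (A.measurableSet_stopSet r)).compl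
  · exact A.measurable_answer t (measurableSet_singleton i)

theorem state_mem_stopsWith (ω : A.Outcome) (t : ℕ) (i : Fin n) :
    A.state t ω ∈ A.stopsWith t i ↔
      A.WantsStop ω t ∧ (∀ r < t, ¬ A.WantsStop ω r) ∧ A.answer t (ω.1, A.history ω t) = i := by
  simp only [stopsWith, state, Set.mem_ofPred_eq, WantsStop, history_castLE, Fin.forall_iff]

theorem returns_iff (ω : A.Outcome) (i : Fin n) :
    A.Returns ω i ↔ ∃ t, A.state t ω ∈ A.stopsWith t i := by
  simp only [state_mem_stopsWith, Returns]

theorem eq_of_state_mem_stopsWith {ω : A.Outcome} {t r : ℕ} {i j : Fin n}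
    (ht : A.state t ω ∈ A.stopsWith t i) (hr : A.state r ω ∈ A.stopsWith r j) :
    t = r := by
  rw [state_mem_stopsWith] at ht hr
  rcases lt_trichotomy t r with h | h | h
  · exact absurd ht.1 (hr.2.1 t h)
  · exact h
  · exact absurd hr.1 (ht.2.1 r h)

theorem not_returns_of_returns {ω : A.Outcome} {i j : Fin n} (hij : i ≠ j)
    (hi : A.Returns ω i) : ¬ A.Returns ω j := by
  intro hj
  obtain ⟨t, ht⟩ := (A.returns_iff ω i).1 hi
  obtain ⟨r, hr⟩ := (A.returns_iff ω j).1 hj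
  obtain rfl := A.eq_of_state_mem_stopsWith ht hr
  exact hij (((A.state_mem_stopsWith ω t i).1 ht).2.2.symm.trans
    ((A.state_mem_stopsWith ω t j).1 hr).2.2)

theorem setOf_returns (i : Fin n) :
    {ω | A.Returns ω i} = ⋃ t, A.state t ⁻¹' A.stopsWith t i := by
  ext ω; simp [returns_iff]

theorem measurableSet_returns (i : Fin n) : MeasurableSet {ω | A.Returns ω i} := by
  rw [setOf_returns]
  exact MeasurableSet.iUnion fun t => A.measurable_state t (A.measurableSet_stopsWith t i)

theorem law_returns (I : Instance n) (i : Fin n) :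
    A.law I {ω | A.Returns ω i} = ∑' t, A.law I (A.state t ⁻¹' A.stopsWith t i) := by
  rw [setOf_returns, measure_iUnion]
  · intro t r htr
    rw [Function.onFun, Set.disjoint_left]
    exact fun ω ht hr => htr (A.eq_of_state_mem_stopsWith ht hr)
  · exact fun t => A.measurable_state t (A.measurableSet_stopsWith t i)

/-- The number of samples of arm `k` in a history. -/
def armCount {t : ℕ} (k : Fin n) (x : History n t) : ℕ :=
  (Finset.univ.filter fun s => (x s).1 = k).card

theorem sum_armCount {t : ℕ} (x : History n t) : ∑ k, armCount k x = t := by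
  have := Finset.card_eq_sum_card_fiberwise (s := (Finset.univ : Finset (Fin t)))
    (t := (Finset.univ : Finset (Fin n))) (f := fun s => (x s).1) (by simp)
  simpa [armCount] using this.symm

theorem measurable_armCount {t : ℕ} (k : Fin n) :
    Measurable fun x : History n t => (armCount k x : ℝ≥0∞) := by
  have : (fun x : History n t => (armCount k x : ℝ≥0∞)) =
      fun x => ∑ s, Set.indicator {p : Fin n × ℝ | p.1 = k} 1 (x s) := by
    funext x
    simp [armCount, Set.indicator_apply]
  rw [this]
  refine Finset.measurable_sum _ fun s _ => ?_
  exact (measurable_one.indicator (measurable_fst (measurableSet_singleton k))).comp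
    (measurable_pi_apply s)

/-- The expected number of samples of arm `k`, on the event that arm `i` is returned. -/
noncomputable def expectedArmSamples (I : Instance n) (i k : Fin n) : ℝ≥0∞ :=
  ∑' t, ∫⁻ ω, (A.stopsWith t i).indicator (fun x => (armCount k x.2 : ℝ≥0∞)) (A.state t ω)
    ∂(A.law I)

/-- On a run returning `i`, the arm counts add up to the stopping time; all other runs, including
those that never stop, contribute nothing to the left side. -/
theorem sum_expectedArmSamples_le (I : Instance n) (i : Fin n) :
    ∑ k, A.expectedArmSamples I i k ≤ A.expectedSamples I := by
  have hm : ∀ t k, Measurable fun ω =>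
      (A.stopsWith t i).indicator (fun x => (armCount k x.2 : ℝ≥0∞)) (A.state t ω) := fun t k =>
    (((measurable_armCount k).comp measurable_snd).indicator
      (A.measurableSet_stopsWith t i)).comp (A.measurable_state t)
  unfold expectedArmSamples expectedSamples
  rw [← Summable.tsum_finsetSum fun _ _ => ENNReal.summable]
  simp_rw [← lintegral_finsetSum _ fun k _ => hm _ k]
  rw [← lintegral_tsum fun t => (Finset.measurable_sum _ fun k _ => hm t k).aemeasurable]
  refine lintegral_mono fun ω => ?_
  have hs : ∀ t, ∑ k, (A.stopsWith t i).indicator (fun x => (armCount k x.2 : ℝ≥0∞))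
      (A.state t ω) = (A.stopsWith t i).indicator (fun _ => (t : ℝ≥0∞)) (A.state t ω) := by
    intro t
    by_cases h : A.state t ω ∈ A.stopsWith t i
    · simp only [Set.indicator_of_mem h]
      rw [← Nat.cast_sum, sum_armCount]
    · simp [h]
  simp only [hs]
  by_cases h : ∃ t, A.state t ω ∈ A.stopsWith t i
  · obtain ⟨t, ht⟩ := h
    rw [tsum_eq_single t fun r hr => Set.indicator_of_notMem
      (fun h => hr (A.eq_of_state_mem_stopsWith h ht)) _, Set.indicator_of_mem ht]
    have h2 : (t : ℕ∞) ≤ A.sampleCount ω := by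
      refine le_iInf₂ fun r hr => ?_
      rw [state_mem_stopsWith] at ht
      exact_mod_cast not_lt.1 fun hlt => ht.2.1 r hlt hr
    exact_mod_cast ENat.toENNReal_le.2 h2
  · push Not at h
    simp [h]

/-! ### The transportation inequality -/

/-- This is log u ≤ u - 1 at u = e^ℓ a and at u = b, added up. Being linear in a, b and N, the
result can be integrated over any event. -/
theorem two_add_le_mul_add_add {a b N ℓ : ℝ} (ha : 0 < a) (hb : 0 < b)
    (h : Real.exp (-N) ≤ a * b) : 2 + ℓ ≤ Real.exp ℓ * a + b + N := by
  have h1 := Real.log_le_sub_one_of_pos (mul_pos (Real.exp_pos ℓ) ha)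
  have h2 := Real.log_le_sub_one_of_pos hb
  have h3 := (Real.le_log_iff_exp_le (mul_pos ha hb)).2 h
  rw [Real.log_mul (Real.exp_ne_zero _) ha.ne', Real.log_exp] at h1
  rw [Real.log_mul ha.ne' hb.ne'] at h3
  linarith

theorem exp_neg_armCount_le {t : ℕ} (x : History n t) {g h : Fin n → ℝ → ℝ}
    (k : Fin n) (κ : ℝ)
    (hk : ∀ y, Real.exp (-κ) ≤ g k y * h k y) (hne : ∀ j ≠ k, ∀ y, 1 ≤ g j y * h j y) :
    Real.exp (-(κ * armCount k x)) ≤ (∏ s, g (x s).1 (x s).2) * ∏ s, h (x s).1 (x s).2 := by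
  have : Real.exp (-(κ * armCount k x)) = ∏ s, if (x s).1 = k then Real.exp (-κ) else 1 := by
    rw [Finset.prod_ite, Finset.prod_const, Finset.prod_const_one, mul_one, ← Real.exp_nat_mul,
      armCount]
    ring_nf
  rw [this, ← Finset.prod_mul_distrib]
  refine Finset.prod_le_prod (fun s _ => by split_ifs <;> positivity) fun s _ => ?_
  split_ifs with hs
  · rw [hs]; exact hk _
  · exact hne _ hs _

/-- A transportation inequality: if the rewards of `I'` and `I''` have densities at least `g` and
`h` with respect to those of `I`, and `g * h` is at least `exp (-κ)` on arm `k` and at least `1` on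
the others, then an algorithm that distinguishes `I` from `I'` has to sample arm `k` often. -/
theorem transport {I I' I'' : Instance n} {g h : Fin n → ℝ → ℝ} (i k : Fin n) {κ ℓ : ℝ}
    (hgm : ∀ j, Measurable (g j)) (hhm : ∀ j, Measurable (h j))
    (hg : ∀ j y, 0 < g j y) (hh : ∀ j y, 0 < h j y)
    (hI' : I.DensityLE I' fun j y => ENNReal.ofReal (g j y))
    (hI'' : I.DensityLE I'' fun j y => ENNReal.ofReal (h j y))
    (hk : ∀ y, Real.exp (-κ) ≤ g k y * h k y) (hne : ∀ j ≠ k, ∀ y, 1 ≤ g j y * h j y)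
    (hκ : 0 ≤ κ) :
    ENNReal.ofReal (2 + ℓ) * A.law I {ω | A.Returns ω i} ≤
      ENNReal.ofReal (Real.exp ℓ) * A.law I' {ω | A.Returns ω i} +
        A.law I'' {ω | A.Returns ω i} + ENNReal.ofReal κ * A.expectedArmSamples I i k := by
  simp only [law_returns, expectedArmSamples]
  rw [← ENNReal.tsum_mul_left, ← ENNReal.tsum_mul_left, ← ENNReal.tsum_mul_left,
    ← ENNReal.tsum_add, ← ENNReal.tsum_add]
  -- Each stopping time is treated separately, so that only finitely many samples carry weights.
  refine ENNReal.tsum_le_tsum fun t => ?_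
  have hB := A.measurableSet_stopsWith t i
  set B := A.stopsWith t i
  have hst := A.measurable_state t
  have hgm' : ∀ j, Measurable fun y => ENNReal.ofReal (g j y) := fun j => (hgm j).ennreal_ofReal
  have hhm' : ∀ j, Measurable fun y => ENNReal.ofReal (h j y) := fun j => (hhm j).ennreal_ofReal
  have h1B : Measurable (B.indicator (1 : A.Seed × History n t → ℝ≥0∞)) :=
    measurable_one.indicator hB
  have hP : ∀ J : Instance n, A.law J (A.state t ⁻¹' B) =
      ∫⁻ ω, B.indicator 1 (A.state t ω) ∂(A.law J) := fun J => by
    rw [← lintegral_indicator_one (hst hB)]; rfl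
  have c1 := A.lintegral_weight_mul_le hgm' hI' t _ h1B
  have c2 := A.lintegral_weight_mul_le hhm' hI'' t _ h1B
  rw [← hP] at c1 c2
  refine le_trans ?_ (add_le_add (add_le_add (mul_le_mul_right c1 _) c2) le_rfl)
  have m1 : Measurable fun ω => weight (fun j y => ENNReal.ofReal (g j y)) (A.state t ω).2 *
      B.indicator 1 (A.state t ω) :=
    (((measurable_weight hgm').comp measurable_snd).mul h1B).comp hst
  have m2 : Measurable fun ω => weight (fun j y => ENNReal.ofReal (h j y)) (A.state t ω).2 *
      B.indicator 1 (A.state t ω) :=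
    (((measurable_weight hhm').comp measurable_snd).mul h1B).comp hst
  have m3 : Measurable fun ω => B.indicator (fun x => (armCount k x.2 : ℝ≥0∞)) (A.state t ω) :=
    (((measurable_armCount k).comp measurable_snd).indicator hB).comp hst
  have m0 : Measurable fun ω => B.indicator (1 : A.Seed × History n t → ℝ≥0∞) (A.state t ω) :=
    h1B.comp hst
  rw [hP, ← lintegral_const_mul _ m0, ← lintegral_const_mul _ m1,
    ← lintegral_const_mul _ m3, ← lintegral_add_left (m1.const_mul _),
    ← lintegral_add_right _ (m3.const_mul _)]
  refine lintegral_mono fun ω => ?_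
  by_cases hω : A.state t ω ∈ B
  · simp only [Set.indicator_of_mem hω, Pi.one_apply, mul_one, weight]
    rw [← ENNReal.ofReal_prod_of_nonneg fun s _ => (hg _ _).le,
      ← ENNReal.ofReal_prod_of_nonneg fun s _ => (hh _ _).le,
      ← ENNReal.ofReal_natCast, ← ENNReal.ofReal_mul (Real.exp_pos _).le,
      ← ENNReal.ofReal_mul hκ, ← ENNReal.ofReal_add, ← ENNReal.ofReal_add]
    · exact ENNReal.ofReal_le_ofReal (two_add_le_mul_add_add
        (Finset.prod_pos fun s _ => hg _ _) (Finset.prod_pos fun s _ => hh _ _)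
        (exp_neg_armCount_le _ k κ hk hne))
    · exact add_nonneg (mul_nonneg (Real.exp_pos _).le (Finset.prod_nonneg fun s _ => (hg _ _).le))
        (Finset.prod_nonneg fun s _ => (hh _ _).le)
    · positivity
    · exact mul_nonneg (Real.exp_pos _).le (Finset.prod_nonneg fun s _ => (hg _ _).le)
    · exact Finset.prod_nonneg fun s _ => (hh _ _).le
  · simp [hω]

end Algorithm
end BestArm

/-! ### Mixtures and replacement of one arm -/

namespace BestArm

/-- The mixture of `ν` with a point mass at `z` of weight `q`. -/
noncomputable def mix (q : ℝ) (ν : Measure ℝ) (z : ℝ) : Measure ℝ :=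
  ENNReal.ofReal (1 - q) • ν + ENNReal.ofReal q • Measure.dirac z

theorem isProbabilityMeasure_mix {q : ℝ} (h0 : 0 ≤ q) (h1 : q ≤ 1) (ν : Measure ℝ)
    [IsProbabilityMeasure ν] (z : ℝ) : IsProbabilityMeasure (mix q ν z) := by
  constructor
  simp only [mix, Measure.add_apply, Measure.smul_apply, measure_univ, smul_eq_mul, mul_one]
  rw [← ENNReal.ofReal_add (by linarith) h0]
  simp

theorem ae_mix {p : ℝ → Prop} (q : ℝ) {ν : Measure ℝ} (hν : ∀ᵐ y ∂ν, p y) {z : ℝ} (hz : p z) :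
    ∀ᵐ y ∂(mix q ν z), p y := by
  rw [mix, ae_add_measure_iff]
  refine ⟨Measure.ae_smul_measure hν _, Measure.ae_smul_measure ?_ _⟩
  rw [ae_dirac_eq]
  exact hz

theorem lintegral_mix (q : ℝ) (ν : Measure ℝ) (z : ℝ) (f : ℝ → ℝ≥0∞) :
    ∫⁻ y, f y ∂(mix q ν z) = ENNReal.ofReal (1 - q) * ∫⁻ y, f y ∂ν + ENNReal.ofReal q * f z := by
  simp [mix]

theorem integral_mix {q : ℝ} (h0 : 0 ≤ q) (h1 : q ≤ 1) {ν : Measure ℝ} (z : ℝ) {f : ℝ → ℝ}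
    (hf : Integrable f ν) :
    ∫ y, f y ∂(mix q ν z) = (1 - q) * ∫ y, f y ∂ν + q * f z := by
  have hd : Integrable f (Measure.dirac z) := integrable_dirac (by simp)
  rw [mix, integral_add_measure (hf.smul_measure ENNReal.ofReal_ne_top)
    (hd.smul_measure ENNReal.ofReal_ne_top), integral_smul_measure, integral_smul_measure,
    integral_dirac, ENNReal.toReal_ofReal (by linarith), ENNReal.toReal_ofReal h0]
  simp

namespace Instance

variable {n : ℕ}

theorem integrable_id (I : Instance n) (i : Fin n) : Integrable (fun y : ℝ => y) (I.reward i) :=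
  Integrable.of_mem_Icc 0 1 aemeasurable_id (I.supported i)

/-- The instance with the reward distribution of arm `k` replaced by `ν`. -/
def replace (I : Instance n) (k : Fin n) (ν : Measure ℝ) (hν : IsProbabilityMeasure ν)
    (hs : ∀ᵐ y ∂ν, y ∈ Set.Icc (0 : ℝ) 1) : Instance n where
  reward := Function.update I.reward k ν
  isProb i := by
    rcases eq_or_ne i k with rfl | h
    · simpa using hν
    · simpa [h] using I.isProb i
  supported i := by
    rcases eq_or_ne i k with rfl | h
    · simpa using hs
    · simpa [h] using I.supported i

variable (I : Instance n) (k : Fin n) {ν : Measure ℝ} (hν : IsProbabilityMeasure ν)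
  (hs : ∀ᵐ y ∂ν, y ∈ Set.Icc (0 : ℝ) 1)

theorem mean_replace_self : (I.replace k ν hν hs).mean k = ∫ y, y ∂ν := by
  simp [mean, replace]

theorem mean_replace_of_ne {j : Fin n} (h : j ≠ k) : (I.replace k ν hν hs).mean j = I.mean j := by
  simp [mean, replace, h]

theorem densityLE_replace {γ : ℝ → ℝ}
    (h : ∀ f : ℝ → ℝ≥0∞, Measurable f →
      ∫⁻ y, ENNReal.ofReal (γ y) * f y ∂(I.reward k) ≤ ∫⁻ y, f y ∂ν) :
    I.DensityLE (I.replace k ν hν hs) fun j y => ENNReal.ofReal (if j = k then γ y else 1) := by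
  intro j f hf
  rcases eq_or_ne j k with rfl | hj
  · simpa [replace] using h f hf
  · simp [replace, hj]

end Instance

/-! ### Consequences of δ-correctness -/

namespace Algorithm

variable {n : ℕ} (A : Algorithm.{u} n)

/-- A `δ`-correct algorithm returns an arm `i` with probability at most `δ` if another arm has
maximal mean, even if this mean is attained more than once. -/
theorem IsCorrect.law_returns_le {A : Algorithm.{u} n} {δ : ℝ} (hA : A.IsCorrect δ)
    (hδ1 : δ ≤ 1) (I : Instance n) {i j : Fin n} (hij : i ≠ j)
    (hj : ∀ k, I.mean k ≤ I.mean j) (hj1 : I.mean j < 1) :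
    A.law I {ω | A.Returns ω i} ≤ ENNReal.ofReal δ := by
  rw [law_returns]
  -- Stopping times are truncated at `M`: giving arm `j` an extra mass ε at 1 makes it the unique
  -- best arm and costs a factor at least (1 - ε)^M, which tends to 1 as ε → 0 with `M` fixed.
  refine ENNReal.tsum_le_of_sum_range_le fun M => ?_
  set S := ∑ t ∈ Finset.range M, A.law I (A.state t ⁻¹' A.stopsWith t i)
  have key : ∀ ε ∈ Set.Ioo (0 : ℝ) 1, ENNReal.ofReal ((1 - ε) ^ M) * S ≤ ENNReal.ofReal δ := by
    rintro ε ⟨hε0, hε1⟩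
    have hp := isProbabilityMeasure_mix hε0.le hε1.le (I.reward j) 1
    have hs := ae_mix ε (I.supported j) (z := 1) (by simp)
    set J := I.replace j _ hp hs with hJ
    have hJj : J.mean j = (1 - ε) * I.mean j + ε := by
      rw [hJ, I.mean_replace_self, integral_mix hε0.le hε1.le _ (I.integrable_id j), mul_one]
      rfl
    have hlt : I.mean j < J.mean j := by rw [hJj]; nlinarith
    have hbest : J.IsBest j := fun k hk => by
      rw [hJ, I.mean_replace_of_ne j hp hs hk, ← hJ]
      exact (hj k).trans_lt hlt
    have hret : A.law J {ω | A.Returns ω i} ≤ ENNReal.ofReal δ := by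
      have hsub : {ω | A.Returns ω i} ⊆ {ω | A.Returns ω j}ᶜ :=
        fun ω hω => A.not_returns_of_returns hij hω
      refine (measure_mono hsub).trans ?_
      rw [prob_compl_eq_one_sub (A.measurableSet_returns j)]
      refine (tsub_le_tsub_left (hA J j hbest) 1).trans ?_
      rw [← ENNReal.ofReal_one, ← ENNReal.ofReal_sub _ (by linarith)]
      exact ENNReal.ofReal_le_ofReal (by linarith)
    -- The same constant serves for all arms, so the weight of a history depends only on its length.
    have hd : I.DensityLE J fun _ _ => ENNReal.ofReal (1 - ε) := by
      intro k f hf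
      rw [lintegral_const_mul _ hf]
      rcases eq_or_ne k j with rfl | hk
      · simp only [hJ, Instance.replace, Function.update_self, lintegral_mix]
        exact le_self_add
      · simp only [hJ, Instance.replace, Function.update_of_ne hk]
        exact mul_le_of_le_one_left (zero_le) (ENNReal.ofReal_le_one.2 (by linarith))
    refine le_trans ?_ hret
    rw [law_returns, Finset.mul_sum]
    refine le_trans (Finset.sum_le_sum fun t ht => ?_) (ENNReal.sum_le_tsum (Finset.range M))
    have hst := A.measurable_state t
    have hB := A.measurableSet_stopsWith t i
    have hP : ∀ J : Instance n, A.law J (A.state t ⁻¹' A.stopsWith t i) =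
        ∫⁻ ω, (A.stopsWith t i).indicator 1 (A.state t ω) ∂(A.law J) := fun J => by
      rw [← lintegral_indicator_one (hst hB)]; rfl
    have h1B : Measurable ((A.stopsWith t i).indicator (1 : A.Seed × History n t → ℝ≥0∞)) :=
      measurable_one.indicator hB
    have m0 : Measurable fun ω =>
        (A.stopsWith t i).indicator (1 : A.Seed × History n t → ℝ≥0∞) (A.state t ω) :=
      h1B.comp hst
    have c := A.lintegral_weight_mul_le (fun _ => measurable_const) hd t _ h1B
    rw [← hP] at c
    refine le_trans ?_ c
    rw [hP, ← lintegral_const_mul _ m0]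
    refine lintegral_mono fun ω => mul_le_mul_left ?_ _
    simp only [weight, Finset.prod_const, Finset.card_univ, Fintype.card_fin]
    rw [← ENNReal.ofReal_pow (by linarith)]
    exact ENNReal.ofReal_le_ofReal
      (pow_le_pow_of_le_one (by linarith) (by linarith) (Finset.mem_range.1 ht).le)
  have hlim : Filter.Tendsto (fun ε : ℝ => ENNReal.ofReal ((1 - ε) ^ M) * S)
      (nhdsWithin 0 (Set.Ioi 0)) (nhds (ENNReal.ofReal ((1 - 0) ^ M) * S)) := by
    refine ENNReal.Tendsto.mul_const ?_ (Or.inl (by simp))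
    have : Continuous fun ε : ℝ => ENNReal.ofReal ((1 - ε) ^ M) :=
      ENNReal.continuous_ofReal.comp (by fun_prop)
    exact this.continuousWithinAt
  have := le_of_tendsto hlim
    (Filter.eventually_of_mem (Ioo_mem_nhdsGT one_pos) key)
  simpa using this

theorem two_le_log_inv {δ : ℝ} (h0 : 0 < δ) (h1 : δ < 0.1) : 2 ≤ Real.log δ⁻¹ := by
  rw [Real.le_log_iff_exp_le (inv_pos.2 h0)]
  have h2 : Real.exp 2 = Real.exp 1 ^ 2 := by rw [← Real.exp_nat_mul]; norm_num
  have h3 := Real.exp_one_lt_d9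
  have h4 := Real.exp_pos 1
  have h5 : (10 : ℝ) ≤ δ⁻¹ := by
    rw [le_inv_comm₀ (by norm_num) h0]; norm_num at h1 ⊢; linarith
  nlinarith

/-- A lower bound for the number of samples of arm `k`, from a change of its reward distribution
after which arm `j` has maximal mean instead of arm `i`. -/
theorem IsCorrect.le_expectedArmSamples {A : Algorithm.{u} n} {δ : ℝ} (hA : A.IsCorrect δ)
    (hδ0 : 0 < δ) (hδ1 : δ < 0.1) (I : Instance n) {i j : Fin n} (k : Fin n) (hij : i ≠ j)
    (hi : I.IsBest i) {ν' ν'' : Measure ℝ}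
    (hp' : IsProbabilityMeasure ν') (hs' : ∀ᵐ y ∂ν', y ∈ Set.Icc (0 : ℝ) 1)
    (hp'' : IsProbabilityMeasure ν'') (hs'' : ∀ᵐ y ∂ν'', y ∈ Set.Icc (0 : ℝ) 1)
    (hj : ∀ l, (I.replace k ν' hp' hs').mean l ≤ (I.replace k ν' hp' hs').mean j)
    (hj1 : (I.replace k ν' hp' hs').mean j < 1)
    {g h : ℝ → ℝ} (hgm : Measurable g) (hhm : Measurable h) (hg : ∀ y, 0 < g y)
    (hh : ∀ y, 0 < h y) {κ : ℝ} (hκ : 0 < κ) (hgh : ∀ y, Real.exp (-κ) ≤ g y * h y)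
    (hν' : ∀ f : ℝ → ℝ≥0∞, Measurable f →
      ∫⁻ y, ENNReal.ofReal (g y) * f y ∂(I.reward k) ≤ ∫⁻ y, f y ∂ν')
    (hν'' : ∀ f : ℝ → ℝ≥0∞, Measurable f →
      ∫⁻ y, ENNReal.ofReal (h y) * f y ∂(I.reward k) ≤ ∫⁻ y, f y ∂ν'') :
    ENNReal.ofReal (4 / 5 * Real.log δ⁻¹ / κ) ≤ A.expectedArmSamples I i k := by
  have hm : ∀ f : ℝ → ℝ, Measurable f → ∀ j : Fin n, Measurable fun y => if j = k then f y else 1 :=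
    fun f hf j => by
      by_cases hjk : j = k
      · simpa [hjk] using hf
      · simp [hjk]
  have hpos : ∀ f : ℝ → ℝ, (∀ y, 0 < f y) → ∀ (j : Fin n) y, 0 < if j = k then f y else 1 :=
    fun f hf j y => by
      split_ifs
      · exact hf y
      · exact one_pos
  have key := A.transport (ℓ := Real.log δ⁻¹) i k (hm g hgm) (hm h hhm) (hpos g hg) (hpos h hh)
    (I.densityLE_replace k hp' hs' hν') (I.densityLE_replace k hp'' hs'' hν'')
    (κ := κ) (by simpa using hgh) (fun j hj y => by simp [hj]) hκ.le
  have h1 := hA I i hi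
  have h2 := hA.law_returns_le (by linarith) _ hij hj hj1
  have hℓ := two_le_log_inv hδ0 hδ1
  set ℓ := Real.log δ⁻¹
  rw [Real.exp_log (inv_pos.2 hδ0)] at key
  set K := A.expectedArmSamples I i k
  -- Of the mirror instance only the trivial bound 1 on its probability is needed, so its means are
  -- irrelevant.
  have h3 : ENNReal.ofReal (2 + ℓ) * ENNReal.ofReal (1 - δ) ≤
      ENNReal.ofReal δ⁻¹ * ENNReal.ofReal δ + 1 + ENNReal.ofReal κ * K :=
    (mul_le_mul_right h1 _).trans (key.trans
      (add_le_add (add_le_add (mul_le_mul_right h2 _) prob_le_one) le_rfl))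
  rcases eq_or_ne K ⊤ with hK | hK
  · rw [hK]; exact le_top
  rw [← ENNReal.ofReal_toReal hK] at h3 ⊢
  rw [← ENNReal.ofReal_mul (by linarith), ← ENNReal.ofReal_mul (inv_pos.2 hδ0).le,
    inv_mul_cancel₀ hδ0.ne', ← ENNReal.ofReal_mul hκ.le, ← ENNReal.ofReal_one,
    ← ENNReal.ofReal_add zero_le_one zero_le_one,
    ← ENNReal.ofReal_add (by norm_num) (by positivity),
    ENNReal.ofReal_le_ofReal_iff (by positivity)] at h3
  -- Now κK ≥ ℓ - δ(2 + ℓ), and ℓ ≥ 2 with δ < 1/10 bounds the loss δ(2 + ℓ) by 2δℓ ≤ ℓ/5.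
  refine ENNReal.ofReal_le_ofReal ?_
  rw [div_le_iff₀ hκ]
  norm_num at hδ1
  nlinarith

end Algorithm

/-! ### Two-point rewards and their alternatives -/

/-- The distribution with mass `1 - w` at `a` and `w` at `b`. -/
noncomputable abbrev twoPoint (w a b : ℝ) : Measure ℝ := mix w (Measure.dirac a) b

theorem integral_twoPoint {w : ℝ} (h0 : 0 ≤ w) (h1 : w ≤ 1) (a b : ℝ) (f : ℝ → ℝ) :
    ∫ y, f y ∂(twoPoint w a b) = (1 - w) * f a + w * f b := by
  rw [integral_mix h0 h1 b (integrable_dirac (by simp)), integral_dirac]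

/-- The density of one two-point distribution with respect to the symmetric one. -/
theorem lintegral_tilt_le {p a b : ℝ} (hab : a ≠ b)
    (f : ℝ → ℝ≥0∞) :
    ∫⁻ y, ENNReal.ofReal (if y = b then 1 + 2 * p else 1 - 2 * p) * f y ∂(twoPoint (1 / 2) a b) ≤
      ∫⁻ y, f y ∂(twoPoint (1 / 2 + p) a b) := by
  simp only [lintegral_mix, lintegral_dirac, hab, if_true, if_false, ← mul_assoc]
  rw [← ENNReal.ofReal_mul (by norm_num), ← ENNReal.ofReal_mul (by norm_num)]
  ring_nf
  exact le_rfl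

theorem supported_twoPoint {m s : ℝ} (hm0 : 2 / 5 ≤ m) (hm1 : m ≤ 1 / 2) (hs : s ^ 2 < 1 / 10)
    (w : ℝ) : ∀ᵐ y ∂(twoPoint w (m - s) (m + s)), y ∈ Set.Icc (0 : ℝ) 1 := by
  obtain ⟨h1, h2⟩ := abs_lt_of_sq_lt_sq' (show s ^ 2 < (2 / 5 : ℝ) ^ 2 by linarith) (by norm_num)
  refine ae_mix w ?_ ⟨by linarith, by linarith⟩
  rw [ae_dirac_eq]
  exact ⟨by linarith, by linarith⟩

theorem exp_neg_le_one_sub_of {x κ : ℝ} (h0 : 0 ≤ x) (h1 : x ≤ 1 / 4) (h : 4 / 3 * x ≤ κ) :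
    Real.exp (-κ) ≤ 1 - x := by
  have h2 : Real.exp (-κ) ≤ (1 + κ)⁻¹ := by
    rw [Real.exp_neg]
    exact inv_anti₀ (by linarith) (by linarith [Real.add_one_le_exp κ])
  refine h2.trans ?_
  rw [inv_le_iff_one_le_mul₀ (by linarith)]
  nlinarith

/-- The mean of a symmetric two-point distribution can be moved to `M` at a small cost. -/
theorem exists_alternative {m s M D : ℝ} (hm0 : 2 / 5 ≤ m) (hm1 : m ≤ 1 / 2)
    (hs : s ^ 2 < 1 / 10) (hD0 : 0 < D) (hD1 : D < 1 / 10) (hM : M - m = D ∨ M - m = -D) :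
    ∃ (ν' ν'' : Measure ℝ) (g h : ℝ → ℝ),
      IsProbabilityMeasure ν' ∧ (∀ᵐ y ∂ν', y ∈ Set.Icc (0 : ℝ) 1) ∧
      IsProbabilityMeasure ν'' ∧ (∀ᵐ y ∂ν'', y ∈ Set.Icc (0 : ℝ) 1) ∧
      ∫ y, y ∂ν' = M ∧ Measurable g ∧ Measurable h ∧ (∀ y, 0 < g y) ∧ (∀ y, 0 < h y) ∧
      (∀ y, Real.exp (-(64 / (s ^ 2 / D ^ 2 + 1 / D))) ≤ g y * h y) ∧
      (∀ f : ℝ → ℝ≥0∞, Measurable f →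
        ∫⁻ y, ENNReal.ofReal (g y) * f y ∂(twoPoint (1 / 2) (m - s) (m + s)) ≤ ∫⁻ y, f y ∂ν') ∧
      (∀ f : ℝ → ℝ≥0∞, Measurable f →
        ∫⁻ y, ENNReal.ofReal (h y) * f y ∂(twoPoint (1 / 2) (m - s) (m + s)) ≤
          ∫⁻ y, f y ∂ν'') := by
  have hsq : (M - m) ^ 2 = D ^ 2 := by rcases hM with h | h <;> simp [h]
  have hprob : ∀ w, 0 ≤ w → w ≤ 1 → IsProbabilityMeasure (twoPoint w (m - s) (m + s)) :=
    fun w h0 h1 => isProbabilityMeasure_mix h0 h1 _ _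
  have hDpos : 0 < s ^ 2 / D ^ 2 + 1 / D := by positivity
  -- The larger of s²/D² and 1/D is at least half of their sum, so the allowed cost is at least 32 D
  -- in the first case and 32 D²/s² in the second.
  rcases le_total (s ^ 2) D with hsD | hsD
  · have hκ : 32 * D ≤ 64 / (s ^ 2 / D ^ 2 + 1 / D) := by
      rw [le_div_iff₀ hDpos]
      have h3 : s ^ 2 / D ^ 2 ≤ 1 / D := by
        rw [div_le_div_iff₀ (by positivity) hD0]; nlinarith
      have h4 : D * (1 / D) = 1 := by field_simp
      nlinarith
    -- The mass q moved to the endpoint is D divided by the distance from m to it, and that distance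
    -- is at least 2/5.
    obtain ⟨q, z, hq0, hq1, hz, hqz⟩ : ∃ q z : ℝ, 0 ≤ q ∧ q ≤ 5 / 2 * D ∧ z ∈ Set.Icc (0 : ℝ) 1 ∧
        (1 - q) * m + q * z = M := by
      rcases hM with h | h
      · have hpos : 0 < 1 - m := by linarith
        refine ⟨D / (1 - m), 1, by positivity, ?_, by simp, ?_⟩
        · rw [div_le_iff₀ hpos]; nlinarith
        · have : D / (1 - m) * (1 - m) = D := div_mul_cancel₀ _ hpos.ne'
          linarith
      · have hpos : 0 < m := by linarith
        refine ⟨D / m, 0, by positivity, ?_, by simp, ?_⟩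
        · rw [div_le_iff₀ hpos]; nlinarith
        · have : D / m * m = D := div_mul_cancel₀ _ hpos.ne'
          linarith
    have hp := hprob (1 / 2) (by norm_num) (by norm_num)
    have hsupp := supported_twoPoint hm0 hm1 hs (1 / 2)
    refine ⟨mix q (twoPoint (1 / 2) (m - s) (m + s)) z, twoPoint (1 / 2) (m - s) (m + s),
      fun _ => 1 - q, fun _ => 1, isProbabilityMeasure_mix hq0 (by linarith) _ _,
      ae_mix q hsupp hz, hp, hsupp, ?_, measurable_const, measurable_const,
      fun _ => by linarith, fun _ => one_pos, fun _ => ?_, fun f hf => ?_, fun f hf => ?_⟩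
    · have hint : Integrable (fun y : ℝ => y) (twoPoint (1 / 2) (m - s) (m + s)) :=
        Integrable.of_mem_Icc 0 1 aemeasurable_id hsupp
      rw [integral_mix hq0 (by linarith) z hint,
        integral_twoPoint (by norm_num) (by norm_num), ← hqz]
      ring
    · rw [mul_one]
      exact exp_neg_le_one_sub_of hq0 (by linarith) (by linarith)
    · rw [lintegral_const_mul _ hf, lintegral_mix q]
      exact le_self_add
    · simp
  · have hs0 : s ≠ 0 := by rintro rfl; norm_num at hsD; linarith
    have hs2 : 0 < s ^ 2 := by positivity
    -- Weights 1/2 ± p on the atoms shift the mean by 2ps, which has to be M - m.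
    set p := (M - m) / (2 * s) with hp
    have hps : 2 * p * s = M - m := by rw [hp]; field_simp
    have hu : (2 * p) ^ 2 = D ^ 2 / s ^ 2 := by
      rw [eq_div_iff hs2.ne', ← mul_pow, hps, hsq]
    have huD : D ^ 2 / s ^ 2 ≤ D := by rw [div_le_iff₀ hs2]; nlinarith
    obtain ⟨hp0, hp1⟩ := abs_lt_of_sq_lt_sq' (show (2 * p) ^ 2 < (1 : ℝ) ^ 2 by linarith) one_pos.le
    have hκ : 32 * (D ^ 2 / s ^ 2) ≤ 64 / (s ^ 2 / D ^ 2 + 1 / D) := by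
      rw [le_div_iff₀ hDpos]
      have h3 : 1 / D ≤ s ^ 2 / D ^ 2 := by
        rw [div_le_div_iff₀ hD0 (by positivity)]; nlinarith
      have h4 : D ^ 2 / s ^ 2 * (s ^ 2 / D ^ 2) = 1 := by field_simp
      have h5 : 0 < D ^ 2 / s ^ 2 := by positivity
      nlinarith
    have hab : m - s ≠ m + s := fun h => hs0 (by linarith)
    have hmeas : ∀ r : ℝ, Measurable fun y : ℝ => if y = m + s then 1 + 2 * r else 1 - 2 * r :=
      fun r => Measurable.ite (measurableSet_singleton _) measurable_const measurable_const
    refine ⟨twoPoint (1 / 2 + p) (m - s) (m + s), twoPoint (1 / 2 + -p) (m - s) (m + s),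
      fun y => if y = m + s then 1 + 2 * p else 1 - 2 * p,
      fun y => if y = m + s then 1 + 2 * (-p) else 1 - 2 * (-p),
      hprob _ (by linarith) (by linarith), supported_twoPoint hm0 hm1 hs _,
      hprob _ (by linarith) (by linarith), supported_twoPoint hm0 hm1 hs _, ?_, hmeas p, hmeas (-p),
      fun y => ?_, fun y => ?_, fun y => ?_, fun f _ => lintegral_tilt_le hab f,
      fun f _ => lintegral_tilt_le hab f⟩
    · rw [integral_twoPoint (by linarith) (by linarith)]
      linarith
    · dsimp only; split_ifs <;> linarith
    · dsimp only; split_ifs <;> linarith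
    -- At either atom the opposite tilts multiply to (1 + 2p)(1 - 2p) = 1 - D²/s².
    · have h6 := exp_neg_le_one_sub_of (x := D ^ 2 / s ^ 2) (by positivity) (by linarith)
        (by linarith [show 0 < D ^ 2 / s ^ 2 by positivity] :
          _ ≤ 64 / (s ^ 2 / D ^ 2 + 1 / D))
      refine h6.trans ?_
      rw [← hu]
      dsimp only
      split_ifs <;> nlinarith

end BestArm

/-! ### The hard instance -/

theorem mainTheorem2 (n : ℕ) (hn : 2 ≤ n) (σ Δ : Fin n → ℝ)
    (hσ : ∀ i, σ i ^ 2 < 0.1)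
    (hΔ_pos : ∀ i, 0 < Δ i) (hΔ_lt : ∀ i, Δ i < 0.1)
    (hΔ_first : Δ ⟨0, by omega⟩ = Δ ⟨1, by omega⟩) (hΔ_mono : Monotone Δ) :
    ∃ I : BestArm.Instance n,
      I.HasParameters hn (fun i => σ i ^ 2) Δ ∧
      (∀ i, ∃ a b : ℝ, I.reward i {a, b} = 1) ∧
      ∀ (δ : ℝ), 0 < δ → δ < 0.1 →
        ∀ A : BestArm.Algorithm.{u} n, A.IsCorrect δ →
          ENNReal.ofReal
              (1 / 80 * (∑ i, (σ i ^ 2 / Δ i ^ 2 + 1 / Δ i)) * Real.log δ⁻¹)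
            ≤ A.expectedSamples I := by
  open BestArm in
  norm_num only at hσ hΔ_lt
  set i₀ : Fin n := ⟨0, by omega⟩ with hi₀
  set i₁ : Fin n := ⟨1, by omega⟩ with hi₁
  have h01 : i₀ ≠ i₁ := by simp [hi₀, hi₁]
  have hle : ∀ k, k ≠ i₀ → i₁ ≤ k := fun k hk => by
    rw [Fin.le_def]
    exact Nat.one_le_iff_ne_zero.2 fun h => hk (Fin.ext h)
  -- All means lie in [2/5, 1/2], which leaves room for atoms at distance |σ_i| < 2/5 inside [0, 1].
  let m : Fin n → ℝ := fun i => if i = i₀ then 1 / 2 else 1 / 2 - Δ i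
  have hm_self : m i₀ = 1 / 2 := by simp [m]
  have hm_ne : ∀ k, k ≠ i₀ → m k = 1 / 2 - Δ k := fun k hk => by simp [m, hk]
  have hm0 : ∀ i, 2 / 5 ≤ m i := fun i => by
    simp only [m]; split_ifs <;> linarith [hΔ_lt i]
  have hm1 : ∀ i, m i ≤ 1 / 2 := fun i => by
    simp only [m]; split_ifs <;> linarith [hΔ_pos i]
  let I : Instance n :=
    { reward := fun i => twoPoint (1 / 2) (m i - σ i) (m i + σ i)
      isProb := fun i => isProbabilityMeasure_mix (by norm_num) (by norm_num) _ _
      supported := fun i => supported_twoPoint (hm0 i) (hm1 i) (hσ i) _ }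
  have hmean : ∀ i, I.mean i = m i := fun i => by
    simp only [Instance.mean, I]
    rw [integral_twoPoint (by norm_num) (by norm_num)]
    ring
  have hvar : ∀ i, I.var i = σ i ^ 2 := fun i => by
    have h := hmean i
    simp only [Instance.mean] at h
    rw [Instance.var, variance_eq_integral (X := fun y : ℝ => y) aemeasurable_id, h]
    simp only [I]
    rw [integral_twoPoint (by norm_num) (by norm_num)]
    ring
  have hbest : I.IsBest i₀ := fun j hj => by
    rw [hmean, hmean, hm_self, hm_ne j hj]
    linarith [hΔ_pos j]
  refine ⟨I, ⟨Equiv.refl _, hbest, fun i j hij => ?_, hvar, fun i hi => ?_⟩,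
    fun i => ⟨m i - σ i, m i + σ i, ?_⟩, fun δ hδ0 hδ1 A hA => ?_⟩
  · simp only [Equiv.refl_apply, hmean]
    rcases eq_or_ne i i₀ with rfl | hi
    · rw [hm_self]; exact hm1 j
    · have hj : j ≠ i₀ := by
        rintro rfl
        exact hi (Fin.ext (Nat.le_zero.1 hij))
      rw [hm_ne i hi, hm_ne j hj]
      linarith [hΔ_mono hij]
  · simp only [Equiv.refl_apply, hmean]
    rw [hm_self, hm_ne i hi]
    ring
  · have := I.isProb i
    rw [prob_compl_eq_zero_iff (by measurability) |>.symm]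
    refine ae_mix (p := fun y => y ∈ ({m i - σ i, m i + σ i} : Set ℝ)) _ ?_ (by simp)
    rw [ae_dirac_eq]
    simp
  · refine le_trans ?_ (A.sum_expectedArmSamples_le I i₀)
    have hterm : ∀ k, ENNReal.ofReal
        (1 / 80 * (σ k ^ 2 / Δ k ^ 2 + 1 / Δ k) * Real.log δ⁻¹) ≤ A.expectedArmSamples I i₀ k := by
      intro k
      have hc : 0 < σ k ^ 2 / Δ k ^ 2 + 1 / Δ k := by
        have := hΔ_pos k
        positivity
      -- The constant arises here: (4/5)/64 = 1/80.
      have hval : 1 / 80 * (σ k ^ 2 / Δ k ^ 2 + 1 / Δ k) * Real.log δ⁻¹ =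
          4 / 5 * Real.log δ⁻¹ / (64 / (σ k ^ 2 / Δ k ^ 2 + 1 / Δ k)) := by
        rw [div_div_eq_mul_div]
        ring
      rw [hval]
      rcases eq_or_ne k i₀ with rfl | hk
      -- The best arm is lowered to tie with the runner-up `i₁`, which uses the convention that the
      -- first two gaps agree.
      · obtain ⟨ν', ν'', g, h, hp', hs', hp'', hs'', hM, hgm, hhm, hg, hh, hgh, hν', hν''⟩ :=
          exists_alternative (M := 1 / 2 - Δ i₀) (hm0 i₀) (hm1 i₀) (hσ i₀) (hΔ_pos i₀)
            (hΔ_lt i₀) (Or.inr (by rw [hm_self]; ring))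
        have hj : (I.replace i₀ ν' hp' hs').mean i₁ = 1 / 2 - Δ i₁ := by
          rw [I.mean_replace_of_ne _ _ _ h01.symm, hmean, hm_ne _ h01.symm]
        refine hA.le_expectedArmSamples hδ0 hδ1 I i₀ h01 hbest hp' hs' hp'' hs'' (fun l => ?_) ?_
          hgm hhm hg hh (by positivity) hgh hν' hν''
        · rw [hj]
          rcases eq_or_ne l i₀ with rfl | hl
          · rw [I.mean_replace_self, hM, hΔ_first]
          · rw [I.mean_replace_of_ne _ _ _ hl, hmean, hm_ne l hl]
            linarith [hΔ_mono (hle l hl)]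
        · rw [hj]; linarith [hΔ_pos i₁]
      -- A suboptimal arm is raised to tie with `i₀`, and itself plays the role of the other maximal
      -- arm.
      · obtain ⟨ν', ν'', g, h, hp', hs', hp'', hs'', hM, hgm, hhm, hg, hh, hgh, hν', hν''⟩ :=
          exists_alternative (M := 1 / 2) (hm0 k) (hm1 k) (hσ k) (hΔ_pos k)
            (hΔ_lt k) (Or.inl (by rw [hm_ne k hk]; ring))
        refine hA.le_expectedArmSamples hδ0 hδ1 I k hk.symm hbest hp' hs' hp'' hs'' (fun l => ?_) ?_
          hgm hhm hg hh (by positivity) hgh hν' hν''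
        · rw [I.mean_replace_self, hM]
          rcases eq_or_ne l k with rfl | hl
          · rw [I.mean_replace_self, hM]
          · rw [I.mean_replace_of_ne _ _ _ hl, hmean]
            exact hm1 l
        · rw [I.mean_replace_self, hM]; norm_num
    rw [Finset.mul_sum, Finset.sum_mul, ENNReal.ofReal_sum_of_nonneg]
    · exact Finset.sum_le_sum fun k _ => hterm k
    · intro k _
      have h1 := hΔ_pos k
      have h2 := Algorithm.two_le_log_inv hδ0 hδ1
      have h3 : 0 ≤ Real.log δ⁻¹ := by linarith
      positivity
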